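/- Let $H=\langle x,y \mid [x,[x,y]],\,[y,[x,y]]\rangle$ be the discrete Heisenberg group. For a generating set $A$ of $H$ and $g\in H$, let $|g|_A$ denote the minimal length of a word in the letters of $A$ and their inverses that represents $g$, let $d_A(g,h)=|g^{-1}h|_A$ be the word metric, and let the (dead-end) depth of $g$ with respect to $A$ be the distance $d_A(g,g')$ from $g$ to the nearest $g'\in H$ with $|g'|_A>|g|_A$ (infinite if there is no such $g'$). Then for every finite generating set $A$ of $H$ there is no bound on the depth with respect to $A$ of the elements of $H$; that is, there is no $N\in\mathbb{N}$ such that every element of $H$ has depth at most $N$ with respect to $A$. -/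

import Mathlib

open scoped commutatorElement

/-- The relators `[x, [x, y]]` and `[y, [x, y]]`, where `x` and `y` are the two free generators. -/
def heisenbergRels : Set (FreeGroup (Fin 2)) :=
  let x : FreeGroup (Fin 2) := FreeGroup.of 0
  let y : FreeGroup (Fin 2) := FreeGroup.of 1
  {⁅x, ⁅x, y⁆⁆, ⁅y, ⁅x, y⁆⁆}

/-- The discrete Heisenberg group `⟨x, y | [x, [x, y]], [y, [x, y]]⟩`. -/
abbrev HeisenbergGroup : Type := PresentedGroup heisenbergRels

/-- `l` is a word in the letters of `A` and their inverses that represents `g`. -/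
def IsWordFor {G : Type*} [Group G] (A : Set G) (g : G) (l : List G) : Prop :=
  (∀ a ∈ l, a ∈ A ∨ a⁻¹ ∈ A) ∧ l.prod = g

/-- The least length of a word in the letters of `A` and their inverses that represents `g`
(meaningful when `A` generates the group, so that there is such a word). -/
noncomputable def wordLength {G : Type*} [Group G] (A : Set G) (g : G) : ℕ :=
  sInf {n : ℕ | ∃ l : List G, IsWordFor A g l ∧ l.length = n}

/-- The word metric on `G` with respect to the generating set `A`. -/
noncomputable def wordDist {G : Type*} [Group G] (A : Set G) (g h : G) : ℕ :=
  wordLength A (g⁻¹ * h)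

/-- The dead-end depth of `g` with respect to `A`: the distance from `g` to the nearest element
that is strictly longer than `g`, and `⊤` if there is no such element. -/
noncomputable def deadEndDepth {G : Type*} [Group G] (A : Set G) (g : G) : ℕ∞ :=
  ⨅ (h : G) (_ : wordLength A g < wordLength A h), (wordDist A g h : ℕ∞)

/-!
Project the Heisenberg group to the plane. A word becomes a polygonal path with edges in a finite
set of vectors, and the central coordinate of its product is, up to an error linear in the length,
twice the area enclosed by the path. Central elements correspond to loops, so their length is
governed by an isoperimetric problem: the largest area `K` of a loop of length `1`. This maximum is
attained (`BlockPath.exists_isOptimalLoop`), and hence a central element of height `R ^ 2` has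
length `R / √K - O(1)` at least (`HeisenbergGroup.le_wordLength_of_plane_eq_zero`).

Central elements are almost local maxima of the length. The optimal loop is a polygon that
only turns left, and every direction of the plane lies in the cone spanned by the two edges at one
of its corners (`BlockPath.IsOptimalLoop.exists_corner`). Given a small vector `v`, start the loop
in the middle of a suitable corner and leave out a piece of that corner with displacement `-v`. The
path that remains has displacement `v`, it is no longer than the loop, and it loses only an amount
of area that is quadratic in `v` (`BlockPath.IsOptimalLoop.exists_path`). After rounding to actual
words, an element at distance `r` from the central element of height `R ^ 2` has length at most
`R / √K + O(r ^ 2 / R + √R + 1)`, provided that `r / R` is small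
(`HeisenbergGroup.exists_wordLength_le_of_near_central`).

If all depths were at most `N`, then from a central element one could move in `j` jumps of size at
most `N` to an element whose length is greater by at least `j`. With `r = O(N * j)` the
bounds above give `j ≤ O(N ^ 2 * j ^ 2 / R + √R + 1)`. This fails when `R = 2 * D * j` for a large
constant `D` and `j` tends to infinity.
-/

/-! ### Coordinates on the Heisenberg group -/

/-- The coordinate model of the Heisenberg group: points of the plane with a height, where heights
add up to the cross product of the plane parts. In this normalization `t` is twice the usual signed
area, which keeps it an integer, and one-parameter subgroups are straight lines. The discrete
Heisenberg group embeds as the subgroup where `t ≡ x * y` modulo `2`. -/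
@[ext]
structure HeisenbergCoord where
  x : ℤ
  y : ℤ
  t : ℤ

namespace HeisenbergCoord

instance : Mul HeisenbergCoord :=
  ⟨fun g h => ⟨g.x + h.x, g.y + h.y, g.t + h.t + (g.x * h.y - g.y * h.x)⟩⟩

instance : One HeisenbergCoord := ⟨⟨0, 0, 0⟩⟩

instance : Inv HeisenbergCoord := ⟨fun g => ⟨-g.x, -g.y, -g.t⟩⟩

@[simp] lemma mul_x (g h : HeisenbergCoord) : (g * h).x = g.x + h.x := rfl
@[simp] lemma mul_y (g h : HeisenbergCoord) : (g * h).y = g.y + h.y := rfl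
@[simp] lemma mul_t (g h : HeisenbergCoord) :
    (g * h).t = g.t + h.t + (g.x * h.y - g.y * h.x) := rfl
@[simp] lemma one_x : (1 : HeisenbergCoord).x = 0 := rfl
@[simp] lemma one_y : (1 : HeisenbergCoord).y = 0 := rfl
@[simp] lemma one_t : (1 : HeisenbergCoord).t = 0 := rfl
@[simp] lemma inv_x (g : HeisenbergCoord) : g⁻¹.x = -g.x := rfl
@[simp] lemma inv_y (g : HeisenbergCoord) : g⁻¹.y = -g.y := rfl
@[simp] lemma inv_t (g : HeisenbergCoord) : g⁻¹.t = -g.t := rfl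

instance : Group HeisenbergCoord :=
  Group.ofLeftAxioms
    (fun a b c => by ext <;> simp <;> ring)
    (fun a => by ext <;> simp)
    (fun a => by ext <;> simp; ring)

end HeisenbergCoord

namespace HeisenbergGroup

/-- The generator `x`. -/
def genX : HeisenbergGroup := PresentedGroup.of 0

/-- The generator `y`. -/
def genY : HeisenbergGroup := PresentedGroup.of 1

/-- The commutator of the two generators, which generates the centre. -/
def central : HeisenbergGroup := ⁅genX, genY⁆

/-- The coordinates of an element, as a homomorphism into the coordinate model. -/
def coord : HeisenbergGroup →* HeisenbergCoord :=
  PresentedGroup.toGroup (f := ![⟨1, 0, 0⟩, ⟨0, 1, 0⟩]) <| by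
    intro r hr
    rcases hr with rfl | rfl <;>
      ext <;> simp [commutatorElement_def]

@[simp] lemma coord_genX : coord genX = ⟨1, 0, 0⟩ := PresentedGroup.toGroup.of _
@[simp] lemma coord_genY : coord genY = ⟨0, 1, 0⟩ := PresentedGroup.toGroup.of _
@[simp] lemma coord_central : coord central = ⟨0, 0, 2⟩ := by
  ext <;> simp [central, commutatorElement_def]

lemma commute_genX_central : Commute genX central := by
  rw [← commutatorElement_eq_one_iff_commute]
  exact PresentedGroup.one_of_mem (rels := heisenbergRels) (Or.inl rfl)

lemma commute_genY_central : Commute genY central := by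
  rw [← commutatorElement_eq_one_iff_commute]
  exact PresentedGroup.one_of_mem (rels := heisenbergRels) (Or.inr rfl)

/-- In a group of class two, commutators are bilinear: `⁅x ^ a, y ^ b⁆ = ⁅x, y⁆ ^ (a * b)`. -/
lemma genX_zpow_mul_genY_zpow (a b : ℤ) :
    genX ^ a * genY ^ b = genY ^ b * genX ^ a * central ^ (a * b) := by
  have hX := commute_genX_central
  have hY := commute_genY_central
  have h1 : genY⁻¹ * genX * genY = genX * central := by
    have : genX * genY = central * (genY * genX) := by
      simp [central, commutatorElement_def, mul_assoc]
    rw [mul_assoc, this, ← mul_assoc, (hY.inv_left).eq, hX.eq]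
    group
  have h2 : genY⁻¹ * genX ^ a * genY = genX ^ a * central ^ a := by
    rw [← hX.mul_zpow, ← h1]
    simpa using (conj_zpow (i := a) (a := genY⁻¹) (b := genX)).symm
  have h3 : genX ^ a * genY * genX ^ (-a) = genY * central ^ a := by
    have h4 : genX ^ a * genY = genY * (central ^ a * genX ^ a) := by
      rw [← (hX.zpow_zpow a a).eq, ← h2]; group
    rw [h4]; group
  have h5 : genX ^ a * genY ^ b * genX ^ (-a) = genY ^ b * central ^ (a * b) := by
    rw [zpow_mul, ← (hY.zpow_right a).mul_zpow, ← h3]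
    simp [conj_zpow, zpow_neg]
  rw [mul_assoc, (hX.zpow_zpow a (a * b)).eq, ← mul_assoc, ← h5]
  group

lemma commute_central (g : HeisenbergGroup) : Commute g central := by
  have h : g ∈ Subgroup.closure (Set.range (PresentedGroup.of (rels := heisenbergRels))) := by
    rw [PresentedGroup.closure_range_of]; trivial
  induction h using Subgroup.closure_induction with
  | mem z hz =>
    obtain ⟨i, rfl⟩ := hz
    fin_cases i
    · exact commute_genX_central
    · exact commute_genY_central
  | one => exact Commute.one_left _
  | mul a b _ _ ha hb => exact ha.mul_left hb
  | inv a _ ha => exact ha.inv_left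

lemma exists_normal_form (g : HeisenbergGroup) :
    ∃ a b m : ℤ, g = genX ^ a * genY ^ b * central ^ m := by
  have h : g ∈ Subgroup.closure (Set.range (PresentedGroup.of (rels := heisenbergRels))) := by
    rw [PresentedGroup.closure_range_of]; trivial
  have hmul : ∀ a b m a' b' m' : ℤ,
      (genX ^ a * genY ^ b * central ^ m) * (genX ^ a' * genY ^ b' * central ^ m') =
        genX ^ (a + a') * genY ^ (b + b') * central ^ (m + m' - a' * b) := by
    intro a b m a' b' m'
    have h1 : genY ^ b * genX ^ a' = genX ^ a' * genY ^ b * central ^ (-(a' * b)) := by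
      rw [genX_zpow_mul_genY_zpow a' b]; group
    have hc : ∀ (g : HeisenbergGroup) (n : ℤ), central ^ n * g = g * central ^ n :=
      fun g n => (((commute_central g).zpow_right n).eq).symm
    calc _ = genX ^ a * genY ^ b * (central ^ m * (genX ^ a' * genY ^ b')) * central ^ m' := by
          group
      _ = genX ^ a * (genY ^ b * genX ^ a') * genY ^ b' * central ^ m * central ^ m' := by
          rw [hc]; group
      _ = genX ^ a * genX ^ a' * genY ^ b * (central ^ (-(a' * b)) * genY ^ b') * central ^ m *
            central ^ m' := by rw [h1]; group
      _ = _ := by rw [hc]; group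
  have hinv : ∀ a b m : ℤ, (genX ^ a * genY ^ b * central ^ m)⁻¹ =
      genX ^ (-a) * genY ^ (-b) * central ^ (-m - a * b) := by
    intro a b m
    rw [inv_eq_iff_mul_eq_one, hmul, show m + (-m - a * b) - -a * b = 0 by ring]
    simp
  induction h using Subgroup.closure_induction with
  | mem z hz =>
    obtain ⟨i, rfl⟩ := hz
    fin_cases i
    · exact ⟨1, 0, 0, by simp [genX]⟩
    · exact ⟨0, 1, 0, by simp [genY]⟩
  | one => exact ⟨0, 0, 0, by simp⟩
  | mul u v _ _ hu hv =>
    obtain ⟨a, b, m, rfl⟩ := hu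
    obtain ⟨a', b', m', rfl⟩ := hv
    exact ⟨_, _, _, hmul _ _ _ _ _ _⟩
  | inv u _ hu =>
    obtain ⟨a, b, m, rfl⟩ := hu
    exact ⟨_, _, _, hinv _ _ _⟩

lemma coord_central_zpow (m : ℤ) : coord (central ^ m) = ⟨0, 0, 2 * m⟩ := by
  have key : ∀ n : ℕ, coord (central ^ n) = ⟨0, 0, 2 * n⟩ := by
    intro n
    induction n with
    | zero => ext <;> simp
    | succ n ih => rw [pow_succ, map_mul, ih]; ext <;> simp; ring
  obtain ⟨n, rfl | rfl⟩ := m.eq_nat_or_neg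
  · rw [zpow_natCast, key]
  · rw [zpow_neg, map_inv, zpow_natCast, key]; ext <;> simp

lemma coord_genX_zpow (m : ℤ) : coord (genX ^ m) = ⟨m, 0, 0⟩ := by
  have key : ∀ n : ℕ, coord (genX ^ n) = ⟨n, 0, 0⟩ := by
    intro n
    induction n with
    | zero => ext <;> simp
    | succ n ih => rw [pow_succ, map_mul, ih]; ext <;> simp
  obtain ⟨n, rfl | rfl⟩ := m.eq_nat_or_neg
  · rw [zpow_natCast, key]
  · rw [zpow_neg, map_inv, zpow_natCast, key]; ext <;> simp

lemma coord_genY_zpow (m : ℤ) : coord (genY ^ m) = ⟨0, m, 0⟩ := by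
  have key : ∀ n : ℕ, coord (genY ^ n) = ⟨0, n, 0⟩ := by
    intro n
    induction n with
    | zero => ext <;> simp
    | succ n ih => rw [pow_succ, map_mul, ih]; ext <;> simp
  obtain ⟨n, rfl | rfl⟩ := m.eq_nat_or_neg
  · rw [zpow_natCast, key]
  · rw [zpow_neg, map_inv, zpow_natCast, key]; ext <;> simp

/-- The coordinates determine the exponents of the normal form; in particular `coord` is injective. -/
lemma exists_eq_of_coord (g : HeisenbergGroup) :
    ∃ m : ℤ, 2 * m = (coord g).t - (coord g).x * (coord g).y ∧
      g = genX ^ (coord g).x * genY ^ (coord g).y * central ^ m := by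
  obtain ⟨a, b, m, rfl⟩ := exists_normal_form g
  refine ⟨m, ?_, ?_⟩ <;>
    simp [coord_genX_zpow, coord_genY_zpow, coord_central_zpow]

end HeisenbergGroup

/-! ### Word length and dead-end depth -/

section WordLength

variable {G : Type*} [Group G] {A : Set G}

lemma wordLength_le_of_isWordFor {g : G} {l : List G} (h : IsWordFor A g l) :
    wordLength A g ≤ l.length :=
  Nat.sInf_le ⟨l, h, rfl⟩

lemma exists_isWordFor_length_eq (hA : Subgroup.closure A = ⊤) (g : G) :
    ∃ l : List G, IsWordFor A g l ∧ l.length = wordLength A g := by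
  have hg : g ∈ Subgroup.closure A := hA ▸ Subgroup.mem_top g
  rw [← Subgroup.mem_toSubmonoid, Subgroup.closure_toSubmonoid] at hg
  obtain ⟨l, hl, hprod⟩ := Submonoid.exists_list_of_mem_closure hg
  exact Nat.sInf_mem (s := {n | ∃ l : List G, IsWordFor A g l ∧ l.length = n})
    ⟨_, l, ⟨hl, hprod⟩, rfl⟩

lemma wordLength_mul_le (hA : Subgroup.closure A = ⊤) (g h : G) :
    wordLength A (g * h) ≤ wordLength A g + wordLength A h := by
  obtain ⟨l, ⟨hl, rfl⟩, hlen⟩ := exists_isWordFor_length_eq hA g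
  obtain ⟨l', ⟨hl', rfl⟩, hlen'⟩ := exists_isWordFor_length_eq hA h
  rw [← hlen, ← hlen', ← List.length_append]
  refine wordLength_le_of_isWordFor ⟨fun a ha => ?_, List.prod_append⟩
  rcases List.mem_append.1 ha with ha | ha
  exacts [hl a ha, hl' a ha]

lemma wordLength_one : wordLength A (1 : G) = 0 :=
  Nat.le_zero.1 <| wordLength_le_of_isWordFor (l := []) ⟨by simp, rfl⟩

lemma wordLength_inv_le (hA : Subgroup.closure A = ⊤) (g : G) :
    wordLength A g⁻¹ ≤ wordLength A g := by
  obtain ⟨l, ⟨hl, rfl⟩, hlen⟩ := exists_isWordFor_length_eq hA g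
  rw [← hlen, List.prod_inv_reverse]
  refine (wordLength_le_of_isWordFor ⟨fun a ha => ?_, rfl⟩).trans (by simp)
  simp only [List.mem_reverse, List.mem_map] at ha
  obtain ⟨b, hb, rfl⟩ := ha
  simpa using (hl b hb).symm

lemma wordLength_pow_le (hA : Subgroup.closure A = ⊤) (g : G) (n : ℕ) :
    wordLength A (g ^ n) ≤ n * wordLength A g := by
  induction n with
  | zero => simp [wordLength_one]
  | succ n ih =>
    rw [pow_succ, Nat.succ_mul]
    exact (wordLength_mul_le hA _ _).trans (Nat.add_le_add_right ih _)

lemma wordLength_zpow_le (hA : Subgroup.closure A = ⊤) (g : G) (n : ℤ) :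
    wordLength A (g ^ n) ≤ n.natAbs * wordLength A g := by
  obtain ⟨m, rfl | rfl⟩ := n.eq_nat_or_neg
  · simpa using wordLength_pow_le hA g m
  · simpa using (wordLength_inv_le hA _).trans (wordLength_pow_le hA g m)

lemma exists_wordLength_lt_of_deadEndDepth_le {g : G} {N : ℕ}
    (h : deadEndDepth A g ≤ N) :
    ∃ u : G, wordLength A g < wordLength A (g * u) ∧ wordLength A u ≤ N := by
  by_contra! hcon
  have : ((N + 1 : ℕ) : ℕ∞) ≤ deadEndDepth A g := by
    refine le_iInf₂ fun k hk => ?_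
    have := hcon (g⁻¹ * k) (by simpa using hk)
    exact_mod_cast this
  have := this.trans h
  norm_cast at this
  omega

/-- If the depth is bounded by `N`, then every element can be lengthened by `k` within distance
`N * k`: escape from a pocket `k` times. -/
lemma exists_add_le_wordLength (hA : Subgroup.closure A = ⊤) {N : ℕ}
    (h : ∀ g : G, deadEndDepth A g ≤ N) (g : G) (k : ℕ) :
    ∃ u : G, wordLength A g + k ≤ wordLength A (g * u) ∧ wordLength A u ≤ N * k := by
  induction k with
  | zero => exact ⟨1, by simp, by simp [wordLength_one]⟩
  | succ k ih =>
    obtain ⟨u, hu, huN⟩ := ih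
    obtain ⟨v, hv, hvN⟩ := exists_wordLength_lt_of_deadEndDepth_le (h (g * u))
    refine ⟨u * v, ?_, ?_⟩
    · rw [← mul_assoc]; omega
    · have := wordLength_mul_le hA u v
      rw [Nat.mul_succ]; omega

end WordLength

namespace HeisenbergGroup

variable {A : Set HeisenbergGroup}

/-- The centre is quadratically distorted. -/
lemma exists_wordLength_central_zpow_le (hA : Subgroup.closure A = ⊤) :
    ∃ D : ℕ, ∀ m : ℤ, wordLength A (central ^ m) ≤ D * (Nat.sqrt m.natAbs + 1) := by
  have hcomm : ∀ p q : ℤ, central ^ (p * q) = ⁅genX ^ p, genY ^ q⁆ := by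
    intro p q
    have hc := ((commute_central (genY ^ q * genX ^ p)).zpow_right (p * q)).eq
    rw [commutatorElement_def, genX_zpow_mul_genY_zpow, hc]
    group
  obtain ⟨a, ha⟩ : ∃ a, wordLength A genX = a := ⟨_, rfl⟩
  obtain ⟨b, hb⟩ : ∃ b, wordLength A genY = b := ⟨_, rfl⟩
  have hlen : ∀ p q : ℤ, wordLength A (central ^ (p * q)) ≤
      2 * (p.natAbs * a) + 2 * (q.natAbs * b) := by
    intro p q
    rw [hcomm, commutatorElement_def]
    have h1 := wordLength_mul_le hA (genX ^ p * genY ^ q * (genX ^ p)⁻¹) (genY ^ q)⁻¹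
    have h2 := wordLength_mul_le hA (genX ^ p * genY ^ q) (genX ^ p)⁻¹
    have h3 := wordLength_mul_le hA (genX ^ p) (genY ^ q)
    have h4 := wordLength_inv_le hA (genX ^ p)
    have h5 := wordLength_inv_le hA (genY ^ q)
    have h6 := wordLength_zpow_le hA genX p
    have h7 := wordLength_zpow_le hA genY q
    rw [ha] at h6
    rw [hb] at h7
    omega
  have hnat : ∀ n : ℕ, wordLength A (central ^ n) ≤ (6 * a + 4 * b) * (Nat.sqrt n + 1) := by
    intro n
    -- write `n = p * p + r * 1` with `r ≤ 2 * p`; each product is a commutator of short elements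
    obtain ⟨r, hr⟩ := Nat.exists_eq_add_of_le (Nat.sqrt_le n)
    have hr2 : r ≤ 2 * Nat.sqrt n := by have := Nat.sqrt_le_add n; omega
    set p := Nat.sqrt n
    have h1 := hlen p p
    have h2 := hlen r 1
    have h3 := wordLength_mul_le hA (central ^ ((p : ℤ) * p)) (central ^ ((r : ℤ) * 1))
    rw [← zpow_add] at h3
    have : central ^ ((p : ℤ) * p + (r : ℤ) * 1) = central ^ n := by
      rw [hr, ← zpow_natCast]; push_cast; simp
    rw [this] at h3
    simp only [Int.natAbs_natCast, Int.natAbs_one] at h1 h2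
    nlinarith [Nat.mul_le_mul_right a hr2]
  refine ⟨6 * a + 4 * b, fun m => ?_⟩
  obtain ⟨n, rfl | rfl⟩ := m.eq_nat_or_neg
  · simpa using hnat n
  · simpa using (wordLength_inv_le hA _).trans (hnat n)

/-- The upper half of the usual estimate of word length by coordinates. Its constant is not sharp:
it is only applied to error terms. -/
lemma exists_wordLength_le (hA : Subgroup.closure A = ⊤) :
    ∃ C : ℝ, 0 ≤ C ∧ ∀ g : HeisenbergGroup, (wordLength A g : ℝ) ≤
      C * (|((coord g).x : ℝ)| + |((coord g).y : ℝ)| + √|((coord g).t : ℝ)| + 1) := by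
  obtain ⟨D, hD⟩ := exists_wordLength_central_zpow_le hA
  obtain ⟨a, ha⟩ : ∃ a, wordLength A genX = a := ⟨_, rfl⟩
  obtain ⟨b, hb⟩ : ∃ b, wordLength A genY = b := ⟨_, rfl⟩
  refine ⟨a + b + D, by positivity, fun g => ?_⟩
  obtain ⟨m, hm, hg⟩ := exists_eq_of_coord g
  set X := (coord g).x
  set Y := (coord g).y
  set t := (coord g).t
  have h1 := wordLength_mul_le hA (genX ^ X * genY ^ Y) (central ^ m)
  have h2 := wordLength_mul_le hA (genX ^ X) (genY ^ Y)
  have h3 := wordLength_zpow_le hA genX X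
  have h4 := wordLength_zpow_le hA genY Y
  have h5 := hD m
  rw [ha] at h3
  rw [hb] at h4
  rw [← hg] at h1
  have h6 : (wordLength A g : ℝ) ≤ |(X : ℝ)| * a + |(Y : ℝ)| * b + D * (Nat.sqrt m.natAbs + 1) := by
    have : wordLength A g ≤ X.natAbs * a + Y.natAbs * b + D * (Nat.sqrt m.natAbs + 1) := by omega
    have h : (wordLength A g : ℝ) ≤
        ((X.natAbs * a + Y.natAbs * b + D * (Nat.sqrt m.natAbs + 1) : ℕ) : ℝ) := by
      exact_mod_cast this
    push_cast at h
    simpa [Nat.cast_natAbs] using h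
  have h7 : (Nat.sqrt m.natAbs : ℝ) ≤ |(X : ℝ)| + |(Y : ℝ)| + √|(t : ℝ)| := by
    have hs : (Nat.sqrt m.natAbs : ℝ) ≤ √|(m : ℝ)| := by
      simpa [Nat.cast_natAbs] using Real.nat_sqrt_le_real_sqrt (a := m.natAbs)
    refine hs.trans (Real.sqrt_le_iff.2 ⟨by positivity, ?_⟩)
    have hm' : 2 * (m : ℝ) = t - X * Y := by exact_mod_cast hm
    have h8 : 2 * |(m : ℝ)| ≤ |(t : ℝ)| + |(X : ℝ)| * |(Y : ℝ)| := by
      rw [← abs_mul, ← abs_two, ← abs_mul, hm']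
      simpa using abs_sub (t : ℝ) (X * Y)
    have h9 := Real.sq_sqrt (abs_nonneg (t : ℝ))
    have hx := abs_nonneg (X : ℝ)
    have hy := abs_nonneg (Y : ℝ)
    have ht := Real.sqrt_nonneg |(t : ℝ)|
    nlinarith [mul_nonneg hx hy, mul_nonneg hx ht, mul_nonneg hy ht, abs_nonneg (m : ℝ)]
  have hx := abs_nonneg (X : ℝ)
  have hy := abs_nonneg (Y : ℝ)
  have ht := Real.sqrt_nonneg |(t : ℝ)|
  have ha0 : (0 : ℝ) ≤ a := by positivity
  have hb0 : (0 : ℝ) ≤ b := by positivity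
  have hD0 : (0 : ℝ) ≤ D := by positivity
  have h8 : (D : ℝ) * (Nat.sqrt m.natAbs + 1) ≤ D * (|(X : ℝ)| + |(Y : ℝ)| + √|(t : ℝ)| + 1) := by
    gcongr
  nlinarith [mul_nonneg ha0 hy, mul_nonneg ha0 ht, mul_nonneg hb0 hx, mul_nonneg hb0 ht]

end HeisenbergGroup

/-! ### Block paths in the plane and their area -/

/-- The cross product of two plane vectors, twice the signed area of the triangle they span. -/
def planeCross (u v : ℝ × ℝ) : ℝ := u.1 * v.2 - u.2 * v.1

lemma planeCross_add_left (u v w : ℝ × ℝ) :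
    planeCross (u + v) w = planeCross u w + planeCross v w := by
  simp only [planeCross, Prod.fst_add, Prod.snd_add]; ring

lemma planeCross_add_right (u v w : ℝ × ℝ) :
    planeCross u (v + w) = planeCross u v + planeCross u w := by
  simp only [planeCross, Prod.fst_add, Prod.snd_add]; ring

lemma planeCross_smul_left (c : ℝ) (u v : ℝ × ℝ) :
    planeCross (c • u) v = c * planeCross u v := by
  simp only [planeCross, Prod.smul_fst, Prod.smul_snd, smul_eq_mul]; ring

lemma planeCross_smul_right (c : ℝ) (u v : ℝ × ℝ) :
    planeCross u (c • v) = c * planeCross u v := by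
  simp only [planeCross, Prod.smul_fst, Prod.smul_snd, smul_eq_mul]; ring

lemma planeCross_swap (u v : ℝ × ℝ) : planeCross u v = -planeCross v u := by
  simp only [planeCross]; ring

@[simp] lemma planeCross_self (u : ℝ × ℝ) : planeCross u u = 0 := by
  simp only [planeCross]; ring

@[simp] lemma planeCross_zero_left (u : ℝ × ℝ) : planeCross 0 u = 0 := by simp [planeCross]

@[simp] lemma planeCross_zero_right (u : ℝ × ℝ) : planeCross u 0 = 0 := by simp [planeCross]

lemma abs_planeCross_le {u v : ℝ × ℝ} {B r : ℝ} (h1 : |u.1| ≤ B) (h2 : |u.2| ≤ B)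
    (hv : |v.1| + |v.2| ≤ r) : |planeCross u v| ≤ B * r := by
  have hB : 0 ≤ B := (abs_nonneg _).trans h1
  calc |planeCross u v| ≤ |u.1 * v.2| + |u.2 * v.1| := abs_sub _ _
    _ = |u.1| * |v.2| + |u.2| * |v.1| := by rw [abs_mul, abs_mul]
    _ ≤ B * |v.2| + B * |v.1| := by gcongr
    _ ≤ B * r := by rw [← mul_add]; gcongr; linarith

namespace BlockPath

variable {α : Type*} (w : α → ℝ × ℝ)

/-! A block path is a list of blocks `(κ, a)`: the letter `a` taken `κ` times, where `κ` is real.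
It traces the polygon in the plane whose successive edges are the vectors `κ • w a`. -/

/-- The total number of letters of a block path. -/
def len : List (ℝ × α) → ℝ
  | [] => 0
  | b :: l => b.1 + len l

/-- The displacement from the start of the polygon to its end. -/
def disp : List (ℝ × α) → ℝ × ℝ
  | [] => 0
  | b :: l => b.1 • w b.2 + disp l

/-- Twice the signed area enclosed by the polygon and the chord that closes it up: the sum of the
cross products of all pairs of edges, taken in order. -/
def area : List (ℝ × α) → ℝ
  | [] => 0
  | b :: l => b.1 * planeCross (w b.2) (disp w l) + area l

/-- All multiplicities are nonnegative. -/
def Nonneg (l : List (ℝ × α)) : Prop := ∀ b ∈ l, 0 ≤ b.1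

/-- The homothetic path, all of whose multiplicities are multiplied by `c`. -/
def scale (c : ℝ) (l : List (ℝ × α)) : List (ℝ × α) := l.map fun b => (c * b.1, b.2)

@[simp] lemma len_nil : len ([] : List (ℝ × α)) = 0 := rfl
@[simp] lemma len_cons (b : ℝ × α) (l) : len (b :: l) = b.1 + len l := rfl
@[simp] lemma disp_nil : disp w [] = 0 := rfl
@[simp] lemma disp_cons (b : ℝ × α) (l) : disp w (b :: l) = b.1 • w b.2 + disp w l := rfl
@[simp] lemma area_nil : area w [] = 0 := rfl
@[simp] lemma area_cons (b : ℝ × α) (l) :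
    area w (b :: l) = b.1 * planeCross (w b.2) (disp w l) + area w l := rfl

@[simp] lemma nonneg_nil : Nonneg ([] : List (ℝ × α)) := by simp [Nonneg]
@[simp] lemma nonneg_cons {b : ℝ × α} {l} : Nonneg (b :: l) ↔ 0 ≤ b.1 ∧ Nonneg l := by
  simp [Nonneg]
@[simp] lemma nonneg_append {l l' : List (ℝ × α)} :
    Nonneg (l ++ l') ↔ Nonneg l ∧ Nonneg l' := by
  simp only [Nonneg, List.mem_append]
  exact ⟨fun h => ⟨fun b hb => h b (Or.inl hb), fun b hb => h b (Or.inr hb)⟩,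
    fun h b hb => hb.elim (h.1 b) (h.2 b)⟩

lemma Nonneg.len_nonneg {l : List (ℝ × α)} (h : Nonneg l) : 0 ≤ len l := by
  induction l with
  | nil => simp
  | cons b l ih =>
    rw [nonneg_cons] at h
    exact add_nonneg h.1 (ih h.2)

@[simp] lemma len_append (l l' : List (ℝ × α)) : len (l ++ l') = len l + len l' := by
  induction l with
  | nil => simp
  | cons b l ih => simp [ih, add_assoc]

@[simp] lemma disp_append (l l' : List (ℝ × α)) : disp w (l ++ l') = disp w l + disp w l' := by
  induction l with
  | nil => simp
  | cons b l ih => simp [ih, add_assoc]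

lemma area_append (l l' : List (ℝ × α)) :
    area w (l ++ l') = area w l + area w l' + planeCross (disp w l) (disp w l') := by
  induction l with
  | nil => simp
  | cons b l ih =>
    simp only [List.cons_append, area_cons, ih, disp_append, disp_cons, planeCross_add_right,
      planeCross_add_left, planeCross_smul_left]
    ring

/-- The area of a loop does not depend on its base point. -/
lemma area_append_comm {l l' : List (ℝ × α)} (h : disp w (l ++ l') = 0) :
    area w (l' ++ l) = area w (l ++ l') := by
  rw [disp_append, add_comm] at h
  rw [area_append, area_append, eq_neg_of_add_eq_zero_left h]
  simp only [planeCross, Prod.fst_neg, Prod.snd_neg]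
  ring

lemma disp_append_comm (l l' : List (ℝ × α)) : disp w (l' ++ l) = disp w (l ++ l') := by
  simp [add_comm]

section Scale

variable (c : ℝ) (l : List (ℝ × α))

@[simp] lemma scale_nil : scale c ([] : List (ℝ × α)) = [] := rfl
@[simp] lemma scale_cons (b : ℝ × α) : scale c (b :: l) = (c * b.1, b.2) :: scale c l := rfl

@[simp] lemma length_scale : (scale c l).length = l.length := by simp [scale]

lemma len_scale : len (scale c l) = c * len l := by
  induction l with
  | nil => simp
  | cons b l ih => simp [ih, mul_add]

lemma disp_scale : disp w (scale c l) = c • disp w l := by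
  induction l with
  | nil => simp
  | cons b l ih => simp [ih, mul_smul]

lemma area_scale : area w (scale c l) = c ^ 2 * area w l := by
  induction l with
  | nil => simp
  | cons b l ih => simp only [scale_cons, area_cons, ih, disp_scale, planeCross_smul_right]; ring

variable {c l} in
lemma Nonneg.scale (hc : 0 ≤ c) (h : Nonneg l) : Nonneg (scale c l) := by
  intro b hb
  obtain ⟨b', hb', rfl⟩ := List.mem_map.1 hb
  exact mul_nonneg hc (h b' hb')

end Scale

/-! ### Existence of an optimal loop -/

/-- All blocks with the same letter can be merged without losing area. When two such blocks are
separated by a path, moving the first across it and moving the second across it change the area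
with opposite signs, so one of the two moves does no harm. -/
lemma exists_nodup_area_le (l : List (ℝ × α)) (hl : Nonneg l) :
    ∃ g : List (ℝ × α), (g.map Prod.snd).Nodup ∧ Nonneg g ∧ len g = len l ∧
      disp w g = disp w l ∧ area w l ≤ area w g := by
  induction l with
  | nil => exact ⟨[], by simp⟩
  | cons b l ih =>
    obtain ⟨p, a⟩ := b
    rw [nonneg_cons] at hl
    obtain ⟨g, hnd, hg, hlen, hdisp, harea⟩ := ih hl.2
    by_cases ha : a ∈ g.map Prod.snd
    · obtain ⟨⟨q, a'⟩, hmem, rfl⟩ := List.mem_map.1 ha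
      obtain ⟨g₁, g₂, rfl⟩ := List.append_of_mem hmem
      simp only [nonneg_append, nonneg_cons] at hg hl
      simp only [len_append, len_cons, disp_append, disp_cons] at hlen hdisp
      have hnd' : (a' :: (g₁ ++ g₂).map Prod.snd).Nodup := by
        rw [List.map_append, ← List.nodup_middle]
        simpa using hnd
      simp only [area_append, area_cons, disp_cons, planeCross_add_right,
        planeCross_smul_right] at harea
      rcases le_total 0 (planeCross (w a') (disp w g₁)) with hs | hs
      · refine ⟨(p + q, a') :: (g₁ ++ g₂), hnd', ?_, ?_, ?_, ?_⟩
        · simp only [nonneg_append, nonneg_cons]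
          exact ⟨add_nonneg hl.1 hg.2.1, hg.1, hg.2.2⟩
        · simp only [len_cons, len_append, ← hlen]; ring
        · simp only [disp_cons, disp_append, ← hdisp, add_smul]; abel
        · simp only [area_cons, ← hdisp, area_append, planeCross_add_right,
            planeCross_smul_right, disp_append, planeCross_self] at harea ⊢
          have := planeCross_swap (disp w g₁) (w a')
          nlinarith [mul_nonneg hg.2.1 hs]
      · refine ⟨g₁ ++ (p + q, a') :: g₂, ?_, ?_, ?_, ?_, ?_⟩
        · simpa using hnd
        · simp only [nonneg_append, nonneg_cons]
          exact ⟨hg.1, add_nonneg hl.1 hg.2.1, hg.2.2⟩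
        · simp only [len_cons, len_append, ← hlen]; ring
        · simp only [disp_cons, disp_append, ← hdisp, add_smul]; abel
        · simp only [area_cons, ← hdisp, area_append, planeCross_add_right,
            planeCross_smul_right, disp_cons, planeCross_self] at harea ⊢
          have := planeCross_swap (disp w g₁) (w a')
          nlinarith [mul_nonneg hl.1 (neg_nonneg.2 hs)]
    · refine ⟨(p, a) :: g, ?_, ?_, ?_, ?_, ?_⟩
      · rw [List.map_cons, List.nodup_cons]; exact ⟨ha, hnd⟩
      · rw [nonneg_cons]; exact ⟨hl.1, hg⟩
      · simp [hlen]
      · simp [hdisp]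
      · simp only [area_cons, hdisp]; linarith

/-- The block path that runs through the letters of `f` in order, `κ a` times the letter `a`. -/
def ofLetters (f : List α) (κ : α → ℝ) : List (ℝ × α) := f.map fun a => (κ a, a)

/-- The multiplicities are bounded by the length on all letters, including those that do not occur,
so that they range over a compact set. -/
lemma exists_ofLetters_eq (g : List (ℝ × α)) (hnd : (g.map Prod.snd).Nodup) (hg : Nonneg g) :
    ∃ κ : α → ℝ, (∀ a, κ a ∈ Set.Icc 0 (len g)) ∧ ofLetters (g.map Prod.snd) κ = g := by
  classical
  induction g with
  | nil => exact ⟨0, by simp, rfl⟩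
  | cons b g ih =>
    obtain ⟨p, a⟩ := b
    rw [List.map_cons, List.nodup_cons] at hnd
    rw [nonneg_cons] at hg
    obtain ⟨κ, hκ, hgκ⟩ := ih hnd.2 hg.2
    have h0 := hg.2.len_nonneg
    refine ⟨Function.update κ a p, fun c => ?_, ?_⟩
    · rcases eq_or_ne c a with rfl | hc
      · simpa using ⟨hg.1, h0⟩
      · have := hκ c
        simp only [Function.update_of_ne hc, len_cons, Set.mem_Icc] at this ⊢
        exact ⟨this.1, by linarith [hg.1]⟩
    · simp only [ofLetters, List.map_cons, Function.update_self, List.cons.injEq, true_and]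
      conv_rhs => rw [← hgκ]
      refine List.map_congr_left fun c hc => ?_
      rw [Function.update_of_ne]
      rintro rfl
      exact hnd.1 hc

lemma continuous_len_ofLetters (f : List α) : Continuous fun κ => len (ofLetters f κ) := by
  induction f with
  | nil => exact continuous_const
  | cons a f ih => exact (continuous_apply a).add ih

lemma continuous_disp_ofLetters (f : List α) : Continuous fun κ => disp w (ofLetters f κ) := by
  induction f with
  | nil => exact continuous_const
  | cons a f ih => exact ((continuous_apply a).smul (continuous_const (y := w a))).add ih

lemma continuous_area_ofLetters (f : List α) : Continuous fun κ => area w (ofLetters f κ) := by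
  induction f with
  | nil => exact continuous_const
  | cons a f ih =>
    have h := continuous_disp_ofLetters w f
    have hc : Continuous fun κ => planeCross (w a) (disp w (ofLetters f κ)) :=
      ((continuous_const (y := (w a).1)).mul h.snd).sub
        ((continuous_const (y := (w a).2)).mul h.fst)
    exact ((continuous_apply a).mul hc).add ih

lemma exists_pos_of_nonneg (l : List (ℝ × α)) (hl : Nonneg l) :
    ∃ g : List (ℝ × α), (∀ b ∈ g, 0 < b.1) ∧ len g = len l ∧
      disp w g = disp w l ∧ area w g = area w l := by
  induction l with
  | nil => exact ⟨[], by simp⟩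
  | cons b l ih =>
    rw [nonneg_cons] at hl
    obtain ⟨g, hg, hlen, hdisp, harea⟩ := ih hl.2
    rcases hl.1.eq_or_lt with h0 | h0
    · exact ⟨g, hg, by simp [hlen, ← h0], by simp [hdisp, ← h0], by simp [harea, ← h0]⟩
    · refine ⟨b :: g, ?_, by simp [hlen], by simp [hdisp], by simp [harea, hdisp]⟩
      simpa [h0] using hg

lemma area_eq_zero_of_len_eq_zero {l : List (ℝ × α)} (hl : Nonneg l) (h : len l = 0) :
    area w l = 0 := by
  induction l with
  | nil => simp
  | cons b l ih =>
    rw [nonneg_cons] at hl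
    rw [len_cons] at h
    have h0 := hl.2.len_nonneg
    have h1 : b.1 = 0 := by linarith [hl.1]
    simp [h1, ih hl.2 (by linarith)]

/-- A loop of length `1` with positive multiplicities that encloses the largest possible area: its
area is the constant of the isoperimetric inequality for loops with the given letters. -/
structure IsOptimalLoop (L : List (ℝ × α)) : Prop where
  pos : ∀ b ∈ L, 0 < b.1
  len_eq : len L = 1
  disp_eq : disp w L = 0
  area_pos : 0 < area w L
  isoperimetric : ∀ l : List (ℝ × α), Nonneg l → disp w l = 0 →
    area w l ≤ area w L * len l ^ 2

/-- By merging blocks, it is enough to compare paths that use every letter at most once. These form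
finitely many compact families, so the largest area is attained. -/
theorem exists_isOptimalLoop [Finite α]
    (h : ∃ l : List (ℝ × α), Nonneg l ∧ disp w l = 0 ∧ 0 < area w l) :
    ∃ L : List (ℝ × α), IsOptimalLoop w L := by
  classical
  have := Fintype.ofFinite α
  let Adm (f : List α) : Set (α → ℝ) :=
    {κ | (∀ a, κ a ∈ Set.Icc 0 1) ∧ len (ofLetters f κ) = 1 ∧ disp w (ofLetters f κ) = 0}
  have hAdm : ∀ f, IsCompact (Adm f) := by
    intro f
    have h1 : IsCompact (Set.univ.pi fun _ : α => Set.Icc (0 : ℝ) 1) :=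
      isCompact_univ_pi fun _ => isCompact_Icc
    have h2 : IsClosed {κ | len (ofLetters f κ) = 1 ∧ disp w (ofLetters f κ) = 0} :=
      (isClosed_eq (continuous_len_ofLetters f) continuous_const).inter
        (isClosed_eq (continuous_disp_ofLetters w f) continuous_const)
    convert h1.inter_right h2 using 1
    ext κ
    simp only [Adm, Set.mem_inter_iff, Set.mem_univ_pi, Set.mem_ofPred_eq]
  let V : Set ℝ :=
    ⋃ f : {f : List α // f.Nodup}, (fun κ => area w (ofLetters f.1 κ)) '' Adm f.1
  have hV : IsCompact V :=
    isCompact_iUnion fun f => (hAdm f.1).image (continuous_area_ofLetters w f.1)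
  have hle : ∀ l : List (ℝ × α), Nonneg l → disp w l = 0 → len l = 1 →
      ∃ v ∈ V, area w l ≤ v := by
    intro l hl hd h1
    obtain ⟨g, hnd, hg, hlen, hdisp, harea⟩ := exists_nodup_area_le w l hl
    obtain ⟨κ, hκ, hgκ⟩ := exists_ofLetters_eq g hnd hg
    rw [hlen, h1] at hκ
    refine ⟨area w g, Set.mem_iUnion.2 ⟨⟨_, hnd⟩, κ, ⟨hκ, ?_, ?_⟩, ?_⟩, harea⟩
    · rw [hgκ, hlen, h1]
    · rw [hgκ, hdisp, hd]
    · simp only [hgκ]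
  have hnorm : ∀ l : List (ℝ × α), Nonneg l → disp w l = 0 → 0 < len l →
      ∃ v ∈ V, area w l ≤ v * len l ^ 2 := by
    intro l hl hd hpos
    obtain ⟨v, hv, hav⟩ := hle (scale (len l)⁻¹ l) (hl.scale (by positivity))
      (by rw [disp_scale, hd, smul_zero]) (by rw [len_scale]; field_simp)
    refine ⟨v, hv, ?_⟩
    rw [area_scale, inv_pow, inv_mul_le_iff₀ (by positivity)] at hav
    linarith
  obtain ⟨l₀, hl₀, hd₀, ha₀⟩ := h
  have hlen₀ : 0 < len l₀ := by
    refine lt_of_le_of_ne hl₀.len_nonneg fun h => ?_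
    rw [area_eq_zero_of_len_eq_zero w hl₀ h.symm] at ha₀
    exact lt_irrefl _ ha₀
  obtain ⟨v₀, hv₀, hav₀⟩ := hnorm l₀ hl₀ hd₀ hlen₀
  obtain ⟨K, hKV, hK⟩ := hV.exists_isGreatest ⟨v₀, hv₀⟩
  obtain ⟨f, κ, ⟨hκ, h1, h0⟩, hKκ⟩ := Set.mem_iUnion.1 hKV
  have hnn : Nonneg (ofLetters f.1 κ) := by
    intro b hb
    obtain ⟨a, -, rfl⟩ := List.mem_map.1 hb
    exact (hκ a).1
  obtain ⟨L, hpos, hlen, hdisp, harea⟩ := exists_pos_of_nonneg w _ hnn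
  have hLK : area w L = K := harea.trans hKκ
  refine ⟨L, hpos, hlen.trans h1, hdisp.trans h0, ?_, fun l hl hd => ?_⟩
  · rw [hLK]
    have := hK hv₀
    by_contra! hcon
    nlinarith [sq_nonneg (len l₀)]
  · rw [hLK]
    rcases hl.len_nonneg.eq_or_lt with h | h
    · rw [area_eq_zero_of_len_eq_zero w hl h.symm, ← h]; simp
    · obtain ⟨v, hv, hav⟩ := hnorm l hl hd h
      exact hav.trans (mul_le_mul_of_nonneg_right (hK hv) (sq_nonneg _))


variable {w}

/-! ### Corners of an optimal loop -/

/-- A cyclic list on which `P` takes both truth values has a step from true to false. -/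
lemma exists_isRotated_cons_cons {β : Type*} (P : β → Prop) (L : List β) (h1 : ∃ b ∈ L, P b)
    (h2 : ∃ b ∈ L, ¬ P b) : ∃ a b l, L ~r (a :: b :: l) ∧ P a ∧ ¬ P b := by
  have key : ∀ (m : List β) (b : β), P b → (∃ c ∈ m, ¬ P c) → ∃ m₁ a c m₂,
      b :: m = m₁ ++ a :: c :: m₂ ∧ P a ∧ ¬ P c := by
    intro m
    induction m with
    | nil => simp
    | cons d m ih =>
      intro b hb hm
      by_cases hd : P d
      · obtain ⟨c, hc, hPc⟩ := hm
        have hcm : c ∈ m := by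
          rcases List.mem_cons.1 hc with rfl | hc
          · exact absurd hd hPc
          · exact hc
        obtain ⟨m₁, a, c, m₂, heq, ha, hc⟩ := ih d hd ⟨c, hcm, hPc⟩
        exact ⟨b :: m₁, a, c, m₂, by rw [heq]; rfl, ha, hc⟩
      · exact ⟨[], b, d, m, rfl, hb, hd⟩
  obtain ⟨b, hb, hPb⟩ := h1
  obtain ⟨l₁, l₂, rfl⟩ := List.append_of_mem hb
  have hrot : (l₁ ++ b :: l₂) ~r (b :: (l₂ ++ l₁)) := by
    simpa using List.isRotated_append (l := l₁) (l' := b :: l₂)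
  have h2' : ∃ c ∈ l₂ ++ l₁, ¬ P c := by
    obtain ⟨c, hc, hPc⟩ := h2
    refine ⟨c, ?_, hPc⟩
    have := hrot.perm.mem_iff.1 hc
    rcases List.mem_cons.1 this with rfl | h
    · exact absurd hPb hPc
    · exact h
  obtain ⟨m₁, a, c, m₂, heq, ha, hc⟩ := key _ b hPb h2'
  refine ⟨a, c, m₂ ++ m₁, hrot.trans ?_, ha, hc⟩
  rw [heq]
  simpa using List.isRotated_append (l := m₁) (l' := a :: c :: m₂)

lemma IsOptimalLoop.of_isRotated {L L' : List (ℝ × α)} (hL : IsOptimalLoop w L) (h : L ~r L') :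
    IsOptimalLoop w L' ∧ area w L' = area w L := by
  obtain ⟨n, rfl⟩ := h
  have hsplit : L.rotate n = L.drop (n % L.length) ++ L.take (n % L.length) :=
    List.rotate_eq_drop_append_take_mod
  have htd : L.take (n % L.length) ++ L.drop (n % L.length) = L := List.take_append_drop _ _
  have harea : area w (L.rotate n) = area w L := by
    rw [hsplit, area_append_comm, htd]
    rw [htd]; exact hL.disp_eq
  refine ⟨⟨fun b hb => hL.pos b (List.mem_rotate.1 hb), ?_, ?_, ?_, ?_⟩, harea⟩
  · rw [hsplit, len_append, add_comm, ← len_append, htd, hL.len_eq]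
  · rw [hsplit, disp_append_comm, htd, hL.disp_eq]
  · rw [harea]; exact hL.area_pos
  · rw [harea]; exact hL.isoperimetric

/-- No loop shorter than an optimal one encloses the same area. -/
lemma IsOptimalLoop.one_le_len {L l : List (ℝ × α)} (hL : IsOptimalLoop w L) (hl : Nonneg l)
    (hd : disp w l = 0) (ha : area w l = area w L) : 1 ≤ len l := by
  have h := hL.isoperimetric l hl hd
  rw [ha] at h
  have h0 := hL.area_pos
  have h1 := hl.len_nonneg
  by_contra! hlt
  have h2 : len l ^ 2 < 1 := by nlinarith
  nlinarith

/-- An optimal loop never turns right: otherwise swapping the two edges would gain area. -/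
lemma IsOptimalLoop.planeCross_nonneg {p q : ℝ} {a b : α} {l : List (ℝ × α)}
    (hL : IsOptimalLoop w ((p, a) :: (q, b) :: l)) : 0 ≤ planeCross (w a) (w b) := by
  have hp := hL.pos (p, a) (by simp)
  have hq := hL.pos (q, b) (by simp)
  have h := hL.isoperimetric ((q, b) :: (p, a) :: l)
    (fun c hc => (hL.pos c (by simp at hc ⊢; tauto)).le)
    (by rw [← hL.disp_eq]; simp only [disp_cons]; abel)
  have hlen : len ((q, b) :: (p, a) :: l) = 1 := by
    rw [← hL.len_eq]; simp only [len_cons]; ring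
  rw [hlen] at h
  simp only [area_cons, disp_cons, planeCross_add_right, planeCross_smul_right] at h
  rw [planeCross_swap (w b) (w a)] at h
  by_contra! hcon
  nlinarith [mul_pos hp hq]

/-- An optimal loop turns strictly left where it passes from one side of the direction `v` to the
other. If the two letters were parallel, they would point in opposite directions (or the second
would vanish) and could be cancelled, which shortens the loop and keeps its area. -/
lemma IsOptimalLoop.planeCross_pos {p q : ℝ} {a b : α} {l : List (ℝ × α)} {v : ℝ × ℝ}
    (hL : IsOptimalLoop w ((p, a) :: (q, b) :: l))
    (ha : 0 < planeCross (w a) v) (hb : planeCross (w b) v ≤ 0) :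
    0 < planeCross (w a) (w b) := by
  refine lt_of_le_of_ne hL.planeCross_nonneg fun h0 => ?_
  have hp := hL.pos (p, a) (by simp)
  have hq := hL.pos (q, b) (by simp)
  simp only at hp hq
  have hl : Nonneg l := fun c hc => (hL.pos c (by simp [hc])).le
  have hlen := hL.len_eq
  have hdisp := hL.disp_eq
  simp only [len_cons, disp_cons] at hlen hdisp
  -- since the two letters are parallel, the second one is a nonpositive multiple of the first one
  obtain ⟨c, hc, hbc⟩ : ∃ c : ℝ, c ≤ 0 ∧ w b = c • w a := by
    refine ⟨planeCross (w b) v / planeCross (w a) v, div_nonpos_of_nonpos_of_nonneg hb ha.le, ?_⟩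
    have hne := ha.ne'
    have e1 : (w b).1 * planeCross (w a) v = planeCross (w b) v * (w a).1 := by
      simp only [planeCross] at h0 ⊢; linear_combination -v.1 * h0
    have e2 : (w b).2 * planeCross (w a) v = planeCross (w b) v * (w a).2 := by
      simp only [planeCross] at h0 ⊢; linear_combination -v.2 * h0
    ext
    · rw [Prod.smul_fst, smul_eq_mul, div_mul_eq_mul_div, eq_div_iff hne, e1]
    · rw [Prod.smul_snd, smul_eq_mul, div_mul_eq_mul_div, eq_div_iff hne, e2]
  have harea : ∀ r : ℝ, ∀ d : α, (r • w d = p • w a + q • w b) →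
      area w ((r, d) :: l) = area w ((p, a) :: (q, b) :: l) := by
    intro r d hr
    simp only [area_cons, disp_cons, planeCross_add_right, planeCross_smul_right, ← h0,
      ← planeCross_smul_left r, hr, planeCross_add_left, planeCross_smul_left]
    ring
  rcases le_total 0 (p + q * c) with hs | hs
  · have hr : (p + q * c) • w a = p • w a + q • w b := by rw [hbc, add_smul, mul_smul]
    have := hL.one_le_len (l := (p + q * c, a) :: l) (nonneg_cons.2 ⟨hs, hl⟩)
      (by rw [disp_cons, hr, add_assoc, hdisp]) (harea _ _ hr)
    simp only [len_cons] at this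
    nlinarith [mul_nonneg hq.le (neg_nonneg.2 hc)]
  · have hc0 : c < 0 := by
      refine lt_of_le_of_ne hc ?_
      rintro rfl
      linarith
    have hr : (q + p / c) • w b = p • w a + q • w b := by
      rw [add_smul, add_comm]
      congr 1
      rw [hbc, smul_smul, div_mul_cancel₀ _ hc0.ne]
    have h1 : p / c < 0 := div_neg_of_pos_of_neg hp hc0
    have h2 : 0 ≤ q + p / c := by
      have : q + p / c = (p + q * c) / c := by
        have := hc0.ne
        field_simp
        ring
      rw [this]
      exact div_nonneg_of_nonpos hs hc
    have := hL.one_le_len (l := (q + p / c, b) :: l) (nonneg_cons.2 ⟨h2, hl⟩)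
      (by rw [disp_cons, hr, add_assoc, hdisp]) (harea _ _ hr)
    simp only [len_cons] at this
    linarith

lemma planeCross_disp_left (v : ℝ × ℝ) (l : List (ℝ × α)) :
    planeCross (disp w l) v = (l.map fun b => b.1 * planeCross (w b.2) v).sum := by
  induction l with
  | nil => simp
  | cons b l ih => simp [planeCross_add_left, planeCross_smul_left, ih]

/-- A path contained in a line encloses no area. -/
lemma area_eq_zero_of_planeCross_eq_zero {v : ℝ × ℝ} (hv : v ≠ 0) (l : List (ℝ × α))
    (h : ∀ b ∈ l, planeCross (w b.2) v = 0) : area w l = 0 := by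
  have hpar : ∀ u u' : ℝ × ℝ, planeCross u v = 0 → planeCross u' v = 0 → planeCross u u' = 0 := by
    intro u u' hu hu'
    simp only [planeCross] at *
    have h1 : v.1 * (u.1 * u'.2 - u.2 * u'.1) = 0 := by
      linear_combination u.1 * (-hu') + u'.1 * hu
    have h2 : v.2 * (u.1 * u'.2 - u.2 * u'.1) = 0 := by
      linear_combination u'.2 * hu - u.2 * hu'
    by_contra hne
    exact hv (Prod.ext ((mul_eq_zero.1 h1).resolve_right hne)
      ((mul_eq_zero.1 h2).resolve_right hne))
  induction l with
  | nil => simp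
  | cons b l ih =>
    have hl : ∀ c ∈ l, planeCross (w c.2) v = 0 := fun c hc => h c (List.mem_cons_of_mem _ hc)
    have hd : planeCross (disp w l) v = 0 := by
      rw [planeCross_disp_left]
      refine List.sum_eq_zero fun x hx => ?_
      obtain ⟨c, hc, rfl⟩ := List.mem_map.1 hx
      rw [hl c hc, mul_zero]
    rw [area_cons, hpar _ _ (h b (by simp)) hd, ih hl]
    simp

/-- Every direction `v` lies in the cone spanned by two consecutive edges of an optimal loop,
because the edges sum to zero and hence lie on both sides of `v`. -/
theorem IsOptimalLoop.exists_corner {L : List (ℝ × α)} (hL : IsOptimalLoop w L) {v : ℝ × ℝ}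
    (hv : v ≠ 0) : ∃ p q a b l, L ~r ((p, a) :: (q, b) :: l) ∧
      0 < planeCross (w a) (w b) ∧ 0 < planeCross (w a) v ∧ planeCross (w b) v ≤ 0 := by
  have hsum : (L.map fun b => b.1 * planeCross (w b.2) v).sum = 0 := by
    rw [← planeCross_disp_left, hL.disp_eq, planeCross_zero_left]
  have hpos : ∃ b ∈ L, 0 < planeCross (w b.2) v := by
    by_contra! hcon
    refine hL.area_pos.ne' (area_eq_zero_of_planeCross_eq_zero hv L fun b hb => ?_)
    have hflip : ∀ u : ℝ × ℝ, planeCross u (-v) = -planeCross u v := fun u => by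
      simp only [planeCross, Prod.fst_neg, Prod.snd_neg]; ring
    have h1 : ∀ x ∈ L.map fun b => b.1 * planeCross (w b.2) (-v), 0 ≤ x := by
      intro x hx
      obtain ⟨c, hc, rfl⟩ := List.mem_map.1 hx
      rw [hflip]
      nlinarith [hL.pos c hc, hcon c hc]
    have h2 : (L.map fun b => b.1 * planeCross (w b.2) (-v)).sum = 0 := by
      rw [← planeCross_disp_left, hL.disp_eq, planeCross_zero_left]
    have h3 := List.all_zero_of_le_zero_le_of_sum_eq_zero h1 h2
      (List.mem_map.2 ⟨b, hb, rfl⟩)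
    have := (hL.pos b hb).ne'
    simpa [hflip, this] using h3
  have hneg : ∃ b ∈ L, ¬ 0 < planeCross (w b.2) v := by
    by_contra! hcon
    have hne : L.map (fun b => b.1 * planeCross (w b.2) v) ≠ [] := by
      obtain ⟨b, hb, -⟩ := hpos
      intro h
      rw [List.map_eq_nil_iff] at h
      simp [h] at hb
    have : 0 < (L.map fun b => b.1 * planeCross (w b.2) v).sum := by
      refine List.sum_pos _ (fun x hx => ?_) hne
      obtain ⟨c, hc, rfl⟩ := List.mem_map.1 hx
      exact mul_pos (hL.pos c hc) (hcon c hc)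
    exact this.ne' hsum
  obtain ⟨⟨p, a⟩, ⟨q, b⟩, l, hrot, ha, hb⟩ :=
    exists_isRotated_cons_cons (fun b : ℝ × α => 0 < planeCross (w b.2) v) L hpos hneg
  exact ⟨p, q, a, b, l, hrot, (hL.of_isRotated hrot).1.planeCross_pos ha (not_lt.1 hb), ha,
    not_lt.1 hb⟩

/-! ### Short paths with prescribed displacement and area -/

lemma exists_le_of_forall_pos (L : List (ℝ × α)) (hL : ∀ b ∈ L, 0 < b.1) :
    ∃ μ > 0, ∀ b ∈ L, μ ≤ b.1 := by
  induction L with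
  | nil => exact ⟨1, one_pos, by simp⟩
  | cons c L ih =>
    obtain ⟨μ, hμ, h⟩ := ih fun b hb => hL b (List.mem_cons_of_mem _ hb)
    refine ⟨min μ c.1, lt_min hμ (hL c (by simp)), fun b hb => ?_⟩
    rcases List.mem_cons.1 hb with rfl | hb
    · exact min_le_right _ _
    · exact (min_le_left _ _).trans (h b hb)

/-- Every vector is a nonnegative combination, with coefficients bounded by its size, of two letters
that meet at a corner of the optimal loop. -/
lemma IsOptimalLoop.exists_corner_decomposition {L : List (ℝ × α)} (hL : IsOptimalLoop w L)
    {B : ℝ} (hB1 : ∀ a, |(w a).1| ≤ B) (hB2 : ∀ a, |(w a).2| ≤ B)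
    (hint : ∀ a b, 0 < planeCross (w a) (w b) → 1 ≤ planeCross (w a) (w b))
    {u : ℝ × ℝ} {r : ℝ} (hu : |u.1| + |u.2| ≤ r) :
    ∃ p q a b l s t, L ~r ((p, a) :: (q, b) :: l) ∧ 0 ≤ s ∧ 0 ≤ t ∧ s ≤ B * r ∧ t ≤ B * r ∧
      0 < planeCross (w a) (w b) ∧ s • w a + t • w b = u := by
  have hr : 0 ≤ r := le_trans (by positivity) hu
  rcases eq_or_ne u 0 with rfl | hne
  -- the zero vector lies in every cone, so any corner will do
  · obtain ⟨p, q, a, b, l, hrot, hab, -, -⟩ := hL.exists_corner (v := (1, 0)) (by simp)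
    have hB : 0 ≤ B := (abs_nonneg _).trans (hB1 a)
    exact ⟨p, q, a, b, l, 0, 0, hrot, le_rfl, le_rfl, by positivity, by positivity, hab, by simp⟩
  · obtain ⟨p, q, a, b, l, hrot, hab, ha, hb⟩ := hL.exists_corner hne
    have h1 := hint a b hab
    have hs : 0 ≤ planeCross u (w b) := by rw [planeCross_swap]; linarith
    have hs' : planeCross u (w b) ≤ B * r := by
      rw [planeCross_swap]
      exact (neg_le_abs _).trans (abs_planeCross_le (hB1 b) (hB2 b) hu)
    have ht' : planeCross (w a) u ≤ B * r :=
      (le_abs_self _).trans (abs_planeCross_le (hB1 a) (hB2 a) hu)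
    refine ⟨p, q, a, b, l, planeCross u (w b) / planeCross (w a) (w b),
      planeCross (w a) u / planeCross (w a) (w b), hrot, by positivity, by positivity,
      (div_le_self hs h1).trans hs', (div_le_self ha.le h1).trans ht', hab, ?_⟩
    have hne := hab.ne'
    ext
    · simp only [Prod.fst_add, Prod.smul_fst, smul_eq_mul]
      field_simp
      simp only [planeCross]; ring
    · simp only [Prod.snd_add, Prod.smul_snd, smul_eq_mul]
      field_simp
      simp only [planeCross]; ring

/-- The area left when a corner, of `s` letters `a` and `t` letters `b`, is removed from the optimal
loop of length `T`. The loss is quadratic in the removed piece, not linear. -/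
lemma IsOptimalLoop.area_cut_corner {p q : ℝ} {a b : α} {l : List (ℝ × α)}
    (hL : IsOptimalLoop w ((p, a) :: (q, b) :: l)) (T s t : ℝ) :
    area w ((T * q - t, b) :: (scale T l ++ [(T * p - s, a)])) =
      T ^ 2 * area w ((p, a) :: (q, b) :: l) - s * t * planeCross (w a) (w b) := by
  have hD : disp w l = -(p • w a + q • w b) := by
    have := hL.disp_eq
    simp only [disp_cons] at this
    rw [eq_neg_iff_add_eq_zero, ← this]; abel
  simp only [area_cons, area_append, disp_append, disp_scale, area_scale, disp_cons, area_nil,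
    disp_nil, hD, planeCross, Prod.fst_add, Prod.snd_add, Prod.fst_neg, Prod.snd_neg,
    Prod.smul_fst, Prod.smul_snd, smul_eq_mul, Prod.fst_zero, Prod.snd_zero]
  ring

/-- A displacement `v` of size at most `r`, together with an area within `r ^ 2` of `R ^ 2`, can be
reached by a path that is longer than the optimal loop of area `R ^ 2` by a *quadratic* term
`O(r ^ 2 / R)` only: remove from an optimal loop a corner with displacement `-v`. -/
theorem IsOptimalLoop.exists_path {L : List (ℝ × α)} (hL : IsOptimalLoop w L)
    {B : ℝ} (hB0 : 0 ≤ B) (hB1 : ∀ a, |(w a).1| ≤ B) (hB2 : ∀ a, |(w a).2| ≤ B)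
    (hint : ∀ a b, 0 < planeCross (w a) (w b) → 1 ≤ planeCross (w a) (w b)) :
    ∃ C ≥ 0, ∃ δ > 0, ∀ (R r τ : ℝ) (v : ℝ × ℝ), 0 < R → |v.1| + |v.2| ≤ r →
      |τ - R ^ 2| ≤ r ^ 2 → r ≤ δ * R → ∃ l : List (ℝ × α), Nonneg l ∧ l.length = L.length ∧
        disp w l = v ∧ area w l = τ ∧ len l ≤ R / √(area w L) + C * (r ^ 2 / R) := by
  obtain ⟨μ, hμ, hμL⟩ := exists_le_of_forall_pos L hL.pos
  set k := √(area w L) with hk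
  have hk0 : 0 < k := Real.sqrt_pos.2 hL.area_pos
  have hkK : k ^ 2 = area w L := Real.sq_sqrt hL.area_pos.le
  refine ⟨(1 + 2 * B ^ 4) / k, by positivity, min (1 / 2) (μ / (2 * k * (B + 1))), by positivity,
    fun R r τ v hR hv hτ hrR => ?_⟩
  have hr : 0 ≤ r := le_trans (by positivity) hv
  have hr1 : r ≤ R / 2 := by
    have := hrR.trans (mul_le_mul_of_nonneg_right (min_le_left _ _) hR.le)
    linarith
  have hr2 : B * r ≤ μ * (R / (2 * k)) := by
    have h := hrR.trans (mul_le_mul_of_nonneg_right (min_le_right _ _) hR.le)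
    rw [div_mul_eq_mul_div, le_div_iff₀ (by positivity)] at h
    rw [← mul_div_assoc, le_div_iff₀ (by positivity)]
    nlinarith [mul_nonneg hk0.le hr]
  obtain ⟨p, q, a, b, l, s, t, hrot, hs0, ht0, hs, ht, hab, hst⟩ :=
    hL.exists_corner_decomposition hB1 hB2 hint (u := -v) (r := r)
      (by simpa only [Prod.fst_neg, Prod.snd_neg, abs_neg] using hv)
  obtain ⟨hL', harea⟩ := hL.of_isRotated hrot
  set c := planeCross (w a) (w b)
  have hc : c ≤ 2 * B ^ 2 := by
    have := (le_abs_self _).trans (abs_planeCross_le (hB1 a) (hB2 a)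
      (add_le_add (hB1 b) (hB2 b)))
    linarith
  have hst0 : 0 ≤ s * t * c := by positivity
  have hstc : s * t * c ≤ 2 * B ^ 4 * r ^ 2 := by
    calc s * t * c ≤ (B * r) * (B * r) * (2 * B ^ 2) := by gcongr
      _ = _ := by ring
  obtain ⟨hτ1, hτ2⟩ := abs_le.1 hτ
  have hsum : R ^ 2 / 4 ≤ τ + s * t * c := by nlinarith
  -- the size of the loop that encloses area exactly `τ` once the corner is removed
  set T := √(τ + s * t * c) / k with hT
  have hT2 : T ^ 2 * area w L = τ + s * t * c := by
    rw [hT, div_pow, Real.sq_sqrt (by nlinarith [sq_nonneg R]), hkK,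
      div_mul_cancel₀ _ hL.area_pos.ne']
  have hTlow : R / (2 * k) ≤ T := by
    rw [hT, ← div_div]
    gcongr
    refine Real.le_sqrt_of_sq_le ?_
    linarith [show (R / 2) ^ 2 = R ^ 2 / 4 by ring]
  have hTup : T ≤ R / k + (1 + 2 * B ^ 4) / k * (r ^ 2 / R) := by
    have : R / k + (1 + 2 * B ^ 4) / k * (r ^ 2 / R) = (R + (1 + 2 * B ^ 4) * (r ^ 2 / R)) / k := by
      field_simp
    rw [this, hT]
    gcongr
    refine Real.sqrt_le_iff.2 ⟨by positivity, ?_⟩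
    have h1 : R * (r ^ 2 / R) = r ^ 2 := by field_simp
    have h2 : (R + (1 + 2 * B ^ 4) * (r ^ 2 / R)) ^ 2 = R ^ 2 + 2 * (1 + 2 * B ^ 4) * r ^ 2 +
        ((1 + 2 * B ^ 4) * (r ^ 2 / R)) ^ 2 := by
      linear_combination 2 * (1 + 2 * B ^ 4) * h1
    rw [h2]
    nlinarith [sq_nonneg ((1 + 2 * B ^ 4) * (r ^ 2 / R)), sq_nonneg r, pow_nonneg hB0 4,
      mul_nonneg (pow_nonneg hB0 4) (sq_nonneg r)]
  have hT0 : 0 ≤ T := le_trans (by positivity) hTlow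
  -- the edges at the corner are long enough for the removal
  have hcoef : ∀ d ∈ ((p, a) :: (q, b) :: l), B * r ≤ T * d.1 := by
    intro d hd
    have h0 := (hL'.pos d hd).le
    have h1 := hμL d (hrot.perm.mem_iff.2 hd)
    calc B * r ≤ μ * (R / (2 * k)) := hr2
      _ ≤ d.1 * T := by gcongr
      _ = T * d.1 := mul_comm _ _
  have hp := hcoef (p, a) (by simp)
  have hq := hcoef (q, b) (by simp)
  have hl : Nonneg l := fun d hd => (hL'.pos d (by simp [hd])).le
  refine ⟨(T * q - t, b) :: (scale T l ++ [(T * p - s, a)]), ?_, ?_, ?_, ?_, ?_⟩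
  · simp only [nonneg_cons, nonneg_append, nonneg_nil, and_true]
    exact ⟨by linarith, hl.scale hT0, by linarith⟩
  · rw [hrot.perm.length_eq]; simp
  · have h0 := hL'.disp_eq
    simp only [disp_cons, disp_append, disp_scale, disp_nil] at h0 ⊢
    calc _ = T • (p • w a + (q • w b + disp w l)) - (s • w a + t • w b) := by module
      _ = v := by rw [h0, hst]; simp
  · rw [hL'.area_cut_corner, harea, hT2]; ring
  · have h1 := hL'.len_eq
    simp only [len_cons, len_append, len_scale, len_nil] at h1 ⊢
    have : T * q - t + (T * len l + (T * p - s + 0)) = T * (p + (q + len l)) - s - t := by ring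
    rw [this, h1]
    linarith

end BlockPath

namespace HeisenbergGroup

/-! ### Words as block paths -/

/-- The image of an element in the abelianization, as a point of the plane. -/
def plane (g : HeisenbergGroup) : ℝ × ℝ := ((coord g).x, (coord g).y)

/-- The central coordinate of an element. -/
def height (g : HeisenbergGroup) : ℝ := (coord g).t

lemma plane_mul (g h : HeisenbergGroup) : plane (g * h) = plane g + plane h := by
  simp [plane]

lemma height_mul (g h : HeisenbergGroup) :
    height (g * h) = height g + height h + planeCross (plane g) (plane h) := by
  simp [height, plane, planeCross]

@[simp] lemma plane_one : plane 1 = 0 := by simp [plane]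
@[simp] lemma height_one : height 1 = 0 := by simp [height]

@[simp] lemma plane_inv (g : HeisenbergGroup) : plane g⁻¹ = -plane g := by
  simp [plane]

@[simp] lemma height_inv (g : HeisenbergGroup) : height g⁻¹ = -height g := by
  simp [height]

lemma plane_pow (g : HeisenbergGroup) (n : ℕ) : plane (g ^ n) = (n : ℝ) • plane g := by
  induction n with
  | zero => simp
  | succ n ih => rw [pow_succ, plane_mul, ih]; push_cast; module

lemma height_pow (g : HeisenbergGroup) (n : ℕ) : height (g ^ n) = n * height g := by
  induction n with
  | zero => simp
  | succ n ih =>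
    rw [pow_succ, height_mul, ih, plane_pow, planeCross_smul_left, planeCross_self]
    push_cast; ring

lemma one_le_planeCross_plane {g h : HeisenbergGroup} (hpos : 0 < planeCross (plane g) (plane h)) :
    1 ≤ planeCross (plane g) (plane h) := by
  simp only [planeCross, plane] at hpos ⊢
  exact_mod_cast hpos

variable {A : Set HeisenbergGroup}

/-- The letters of words: the generators in `A` and their inverses. -/
abbrev Letter (A : Set HeisenbergGroup) : Type := {a : HeisenbergGroup // a ∈ A ∨ a⁻¹ ∈ A}

lemma finite_letter (hfin : A.Finite) : Finite (Letter A) := by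
  have : (A ∪ A⁻¹).Finite := hfin.union hfin.inv
  exact this.to_subtype

/-- The edge vectors of block paths whose multiplicities count letters. -/
def letterPlane (A : Set HeisenbergGroup) (a : Letter A) : ℝ × ℝ := plane a.1

lemma wordLength_letter_le (a : Letter A) : wordLength A a.1 ≤ 1 :=
  wordLength_le_of_isWordFor (l := [a.1]) ⟨by simpa using a.2, by simp⟩

lemma exists_letter_bound (hfin : A.Finite) : ∃ B : ℝ, 1 ≤ B ∧ ∀ a : Letter A,
    |(plane a.1).1| ≤ B ∧ |(plane a.1).2| ≤ B ∧ |height a.1| ≤ B := by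
  have := finite_letter hfin
  obtain ⟨B₁, h1⟩ := Finite.bddAbove_range fun a : Letter A => |(plane a.1).1|
  obtain ⟨B₂, h2⟩ := Finite.bddAbove_range fun a : Letter A => |(plane a.1).2|
  obtain ⟨B₃, h3⟩ := Finite.bddAbove_range fun a : Letter A => |height a.1|
  refine ⟨max 1 (max B₁ (max B₂ B₃)), le_max_left _ _, fun a => ⟨?_, ?_, ?_⟩⟩
  · exact (h1 ⟨a, rfl⟩).trans (by simp)
  · exact (h2 ⟨a, rfl⟩).trans (by simp)
  · exact (h3 ⟨a, rfl⟩).trans (by simp)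

/-- A word is a block path with all multiplicities `1`, and the height of its product is the area
of this path up to the heights of the letters themselves. -/
lemma exists_blockPath_of_wordLength (hA : Subgroup.closure A = ⊤) {B : ℝ}
    (hB : ∀ a : Letter A, |height a.1| ≤ B) (g : HeisenbergGroup) :
    ∃ l : List (ℝ × Letter A), BlockPath.Nonneg l ∧ BlockPath.len l = wordLength A g ∧
      BlockPath.disp (letterPlane A) l = plane g ∧
      |height g - BlockPath.area (letterPlane A) l| ≤ B * wordLength A g := by
  obtain ⟨m, ⟨hm, rfl⟩, hlen⟩ := exists_isWordFor_length_eq hA g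
  rw [← hlen]
  clear hlen
  induction m with
  | nil => exact ⟨[], by simp⟩
  | cons a m ih =>
    obtain ⟨l, hl, hlen, hdisp, hht⟩ := ih fun b hb => hm b (List.mem_cons_of_mem _ hb)
    have ha := hm a (by simp)
    refine ⟨(1, ⟨a, ha⟩) :: l, ?_, ?_, ?_, ?_⟩
    · simpa using hl
    · simp [hlen, add_comm]
    · simp [hdisp, plane_mul, letterPlane]
    · have hBa := hB ⟨a, ha⟩
      simp only at hBa
      rw [List.prod_cons, height_mul, BlockPath.area_cons, hdisp, letterPlane, one_mul,
        List.length_cons, Nat.cast_succ]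
      rw [abs_le] at hBa hht ⊢
      constructor <;> linarith [hBa.1, hBa.2, hht.1, hht.2]

lemma abs_height_le_wordLength (hA : Subgroup.closure A = ⊤) {B : ℝ} (hB1 : 1 ≤ B)
    (hB : ∀ a : Letter A, |(plane a.1).1| ≤ B ∧ |(plane a.1).2| ≤ B ∧ |height a.1| ≤ B)
    (g : HeisenbergGroup) :
    |(plane g).1| + |(plane g).2| ≤ 2 * B * wordLength A g ∧
      |height g| ≤ 2 * B ^ 2 * (wordLength A g : ℝ) ^ 2 := by
  obtain ⟨m, ⟨hm, rfl⟩, hlen⟩ := exists_isWordFor_length_eq hA g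
  rw [← hlen]
  clear hlen
  induction m with
  | nil => simp
  | cons a m ih =>
    obtain ⟨h1, h2⟩ := ih fun b hb => hm b (List.mem_cons_of_mem _ hb)
    obtain ⟨hx, hy, hh⟩ := hB ⟨a, hm a (by simp)⟩
    simp only at hx hy hh
    have hc := abs_planeCross_le hx hy h1
    rw [List.prod_cons, plane_mul, height_mul, List.length_cons, Nat.cast_succ, Prod.fst_add,
      Prod.snd_add]
    constructor
    · have e1 := abs_add_le (plane a).1 (plane m.prod).1
      have e2 := abs_add_le (plane a).2 (plane m.prod).2
      linarith
    · have e1 := abs_add_le (height a + height m.prod) (planeCross (plane a) (plane m.prod))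
      have e2 := abs_add_le (height a) (height m.prod)
      nlinarith [sq_nonneg B]

/-- Rounding the multiplicities of a block path down gives a word. The displacement changes by a
bounded amount for each block, the height by an amount that is linear in the length. -/
lemma exists_wordLength_le_len (hA : Subgroup.closure A = ⊤) {B : ℝ} (hB1 : 1 ≤ B)
    (hB : ∀ a : Letter A, |(plane a.1).1| ≤ B ∧ |(plane a.1).2| ≤ B ∧ |height a.1| ≤ B)
    (l : List (ℝ × Letter A)) (hl : BlockPath.Nonneg l) :
    ∃ g : HeisenbergGroup, (wordLength A g : ℝ) ≤ BlockPath.len l ∧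
      |(plane g - BlockPath.disp (letterPlane A) l).1| +
        |(plane g - BlockPath.disp (letterPlane A) l).2| ≤ 2 * B * l.length ∧
      |height g - BlockPath.area (letterPlane A) l| ≤
        (2 * B ^ 2 * l.length + B) * BlockPath.len l := by
  induction l with
  | nil => exact ⟨1, by simp [wordLength_one]⟩
  | cons b l ih =>
    obtain ⟨κ, a⟩ := b
    rw [BlockPath.nonneg_cons] at hl
    obtain ⟨hκ, hl⟩ := hl
    obtain ⟨g, hlen, hdisp, hht⟩ := ih hl
    obtain ⟨hx, hy, hh⟩ := hB a
    simp only at hκ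
    set n := ⌊κ⌋₊
    have hn1 : (n : ℝ) ≤ κ := Nat.floor_le hκ
    have hn2 : κ - n ≤ 1 := by linarith [Nat.lt_floor_add_one κ]
    have hB0 : 0 ≤ B := by linarith
    set d := BlockPath.disp (letterPlane A) l with hd
    set e := plane g - d with he
    have hdl : |d.1| + |d.2| ≤ 2 * B * BlockPath.len l := by
      rw [hd]
      clear * - hl hB
      induction l with
      | nil => simp
      | cons b l ih =>
        rw [BlockPath.nonneg_cons] at hl
        have h := ih hl.2
        obtain ⟨hx, hy, -⟩ := hB b.2
        have e1 := abs_add_le (b.1 * (plane b.2.1).1) (BlockPath.disp (letterPlane A) l).1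
        have e2 := abs_add_le (b.1 * (plane b.2.1).2) (BlockPath.disp (letterPlane A) l).2
        rw [abs_mul, abs_of_nonneg hl.1] at e1 e2
        have e3 := mul_le_mul_of_nonneg_left hx hl.1
        have e4 := mul_le_mul_of_nonneg_left hy hl.1
        simp only [BlockPath.disp_cons, Prod.fst_add, Prod.snd_add, Prod.smul_fst, Prod.smul_snd,
          smul_eq_mul, letterPlane, BlockPath.len_cons] at h e1 e2 ⊢
        linarith
    refine ⟨a.1 ^ n * g, ?_, ?_, ?_⟩
    · have h1 := wordLength_mul_le hA (a.1 ^ n) g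
      have h2 := wordLength_pow_le hA a.1 n
      have h3 := Nat.mul_le_mul_left n (wordLength_letter_le a)
      have h4 : wordLength A (a.1 ^ n * g) ≤ n + wordLength A g := by omega
      have h5 : (wordLength A (a.1 ^ n * g) : ℝ) ≤ n + wordLength A g := by exact_mod_cast h4
      rw [BlockPath.len_cons]
      linarith
    · have hplane : plane (a.1 ^ n * g) - BlockPath.disp (letterPlane A) ((κ, a) :: l) =
          e - (κ - n) • plane a.1 := by
        rw [plane_mul, plane_pow, BlockPath.disp_cons, letterPlane, he]
        module
      have hκn : 0 ≤ κ - n := by linarith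
      rw [hplane, Prod.fst_sub, Prod.snd_sub, Prod.smul_fst, Prod.smul_snd, smul_eq_mul,
        smul_eq_mul, List.length_cons, Nat.cast_succ]
      have e1 := abs_sub e.1 ((κ - n) * (plane a.1).1)
      have e2 := abs_sub e.2 ((κ - n) * (plane a.1).2)
      rw [abs_mul, abs_of_nonneg hκn] at e1 e2
      have e3 := mul_le_mul hn2 hx (abs_nonneg _) zero_le_one
      have e4 := mul_le_mul hn2 hy (abs_nonneg _) zero_le_one
      linarith
    · have hdiff : height (a.1 ^ n * g) - BlockPath.area (letterPlane A) ((κ, a) :: l) =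
          n * height a.1 + (height g - BlockPath.area (letterPlane A) l) +
            n * planeCross (plane a.1) e - (κ - n) * planeCross (plane a.1) d := by
        rw [height_mul, height_pow, plane_pow, planeCross_smul_left, BlockPath.area_cons,
          letterPlane, ← hd, show plane g = e + d by rw [he]; abel, planeCross_add_right]
        ring
      have hκn : 0 ≤ κ - n := by linarith
      have hn0 : (0 : ℝ) ≤ n := Nat.cast_nonneg n
      have c1 := abs_planeCross_le hx hy hdisp
      have c2 := abs_planeCross_le hx hy hdl
      have d1 : |(n : ℝ) * height a.1| ≤ κ * B := by
        rw [abs_mul, abs_of_nonneg hn0]; gcongr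
      have d2 : |(n : ℝ) * planeCross (plane a.1) e| ≤ κ * (B * (2 * B * l.length)) := by
        rw [abs_mul, abs_of_nonneg hn0]; gcongr
      have d3 : |(κ - n) * planeCross (plane a.1) d| ≤
          1 * (B * (2 * B * BlockPath.len l)) := by
        rw [abs_mul, abs_of_nonneg hκn]; gcongr
      rw [hdiff, List.length_cons, Nat.cast_succ, BlockPath.len_cons]
      refine (abs_sub _ _).trans ?_
      refine (add_le_add (abs_add_le _ _) le_rfl).trans ?_
      have e1 := abs_add_le ((n : ℝ) * height a.1)
        (height g - BlockPath.area (letterPlane A) l)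
      have h0 : 0 ≤ 2 * B ^ 2 * κ := by positivity
      linear_combination e1 + d1 + d2 + d3 + hht + h0

/-! ### Length of elements near the centre -/

/-- Up to an error `O(√R)`, elements within `r` of the central element of height `R ^ 2` are longer
than that element by a term that is only quadratic in `r`. -/
theorem exists_wordLength_le_of_near_central (hfin : A.Finite) (hA : Subgroup.closure A = ⊤)
    {L : List (ℝ × Letter A)} (hL : BlockPath.IsOptimalLoop (letterPlane A) L) :
    ∃ C ≥ 0, ∃ δ > 0, ∀ (R r : ℝ) (g : HeisenbergGroup), 0 < R →
      |(plane g).1| + |(plane g).2| ≤ r → |height g - R ^ 2| ≤ r ^ 2 → r ≤ δ * R →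
      (wordLength A g : ℝ) ≤
        R / √(BlockPath.area (letterPlane A) L) + C * (r ^ 2 / R + √R + 1) := by
  obtain ⟨B, hB1, hB⟩ := exists_letter_bound hfin
  have hB0 : 0 ≤ B := by linarith
  obtain ⟨C₁, hC₁, δ, hδ, hpath⟩ := hL.exists_path hB0 (fun a => (hB a).1) (fun a => (hB a).2.1)
    (fun a b => one_le_planeCross_plane)
  obtain ⟨C₀, hC₀, hrough⟩ := exists_wordLength_le hA
  set k := √(BlockPath.area (letterPlane A) L)
  have hk : 0 < k := Real.sqrt_pos.2 hL.area_pos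
  set m : ℝ := (L.length : ℝ)
  set E : ℝ := (2 * B ^ 2 * m + B) * (1 / k + C₁ * δ ^ 2) + 2 * B ^ 2 * m * δ with hE
  have hE0 : 0 ≤ E := by positivity
  have hm0 : 0 ≤ m := Nat.cast_nonneg _
  refine ⟨C₁ + C₀ * (2 * B * m + √E + 1), by positivity, δ, hδ,
    fun R r g hR hr hht hrR => ?_⟩
  have hr0 : 0 ≤ r := le_trans (by positivity) hr
  obtain ⟨l, hl, hlength, hdisp, harea, hlen⟩ := hpath R r (height g) (plane g) hR hr hht hrR
  obtain ⟨g₀, hg₀, hd₀, hh₀⟩ := exists_wordLength_le_len hA hB1 hB l hl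
  rw [hlength, hdisp] at hd₀
  rw [hlength, harea] at hh₀
  have hlenR : BlockPath.len l ≤ (1 / k + C₁ * δ ^ 2) * R := by
    have : r ^ 2 / R ≤ δ ^ 2 * R := by
      rw [div_le_iff₀ hR]
      calc r ^ 2 ≤ (δ * R) ^ 2 := by gcongr
        _ = _ := by ring
    calc _ ≤ R / k + C₁ * (r ^ 2 / R) := hlen
      _ ≤ R / k + C₁ * (δ ^ 2 * R) := by gcongr
      _ = _ := by ring
  -- the rounding error has bounded displacement and height `O(R)`, hence length `O(√R)`
  have hhE : |height (g₀⁻¹ * g)| ≤ E * R := by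
    have heq : height (g₀⁻¹ * g) =
        -(height g₀ - height g) + planeCross (plane g) (plane g₀ - plane g) := by
      rw [height_mul, height_inv, plane_inv]
      simp only [planeCross, Prod.fst_neg, Prod.snd_neg, Prod.fst_sub, Prod.snd_sub]
      ring
    have hx : |(plane g).1| ≤ r := by linarith [abs_nonneg (plane g).2]
    have hy : |(plane g).2| ≤ r := by linarith [abs_nonneg (plane g).1]
    have h1 := abs_planeCross_le hx hy hd₀
    rw [heq]
    refine (abs_add_le _ _).trans ?_
    rw [abs_neg]
    have h2 : (2 * B ^ 2 * m + B) * BlockPath.len l ≤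
        (2 * B ^ 2 * m + B) * ((1 / k + C₁ * δ ^ 2) * R) := by gcongr
    have h3 : r * (2 * B * m) ≤ δ * R * (2 * B ^ 2 * m) := by
      have : B ≤ B ^ 2 := by nlinarith
      gcongr
    rw [hE]
    linarith
  have hplane : |(plane (g₀⁻¹ * g)).1| + |(plane (g₀⁻¹ * g)).2| ≤ 2 * B * m := by
    have : plane (g₀⁻¹ * g) = -(plane g₀ - plane g) := by rw [plane_mul, plane_inv]; abel
    rw [this, Prod.fst_neg, Prod.snd_neg, abs_neg, abs_neg]
    exact hd₀
  have hsqrt : √|height (g₀⁻¹ * g)| ≤ √E * √R := by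
    rw [← Real.sqrt_mul hE0]
    exact Real.sqrt_le_sqrt hhE
  have h1 : (wordLength A (g₀⁻¹ * g) : ℝ) ≤ C₀ * (2 * B * m + √E * √R + 1) := by
    refine (hrough _).trans (mul_le_mul_of_nonneg_left ?_ hC₀)
    simp only [plane, height] at hplane hsqrt
    linarith
  have h2 : (wordLength A g : ℝ) ≤ wordLength A g₀ + wordLength A (g₀⁻¹ * g) := by
    have := wordLength_mul_le hA g₀ (g₀⁻¹ * g)
    rw [mul_inv_cancel_left] at this
    exact_mod_cast this
  have hq : 0 ≤ r ^ 2 / R := by positivity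
  have hsR := Real.sqrt_nonneg R
  have hsE := Real.sqrt_nonneg E
  have h3 : 2 * B * m + √E * √R + 1 ≤ (2 * B * m + √E + 1) * (r ^ 2 / R + √R + 1) := by
    have : 0 ≤ 2 * B * m := by positivity
    nlinarith [mul_nonneg this hq, mul_nonneg this hsR, mul_nonneg hsE hq]
  have h4 := mul_le_mul_of_nonneg_left h3 hC₀
  have h5 : C₁ * (r ^ 2 / R) ≤ C₁ * (r ^ 2 / R + √R + 1) := by
    gcongr
    linarith
  linarith

/-- The isoperimetric inequality bounds the length of central elements from below. -/
lemma le_wordLength_of_plane_eq_zero (hA : Subgroup.closure A = ⊤)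
    {L : List (ℝ × Letter A)} (hL : BlockPath.IsOptimalLoop (letterPlane A) L)
    {B : ℝ} (hB : ∀ a : Letter A, |height a.1| ≤ B) (g : HeisenbergGroup) (hg : plane g = 0) :
    height g ≤ BlockPath.area (letterPlane A) L * (wordLength A g : ℝ) ^ 2 +
      B * wordLength A g := by
  obtain ⟨l, hl, hlen, hdisp, hht⟩ := exists_blockPath_of_wordLength hA hB g
  have h := hL.isoperimetric l hl (hdisp.trans hg)
  rw [hlen] at h
  linarith [(abs_le.1 hht).2]

/-- The letters are not all parallel in the plane, because they generate the abelianization. -/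
lemma exists_letter_planeCross_pos (hA : Subgroup.closure A = ⊤) :
    ∃ a b : Letter A, 0 < planeCross (plane a.1) (plane b.1) := by
  by_contra! hcon
  have h0 : ∀ a b : Letter A, planeCross (plane a.1) (plane b.1) = 0 := fun a b =>
    le_antisymm (hcon a b) (by rw [planeCross_swap]; linarith [hcon b a])
  have hgen : ∀ g : HeisenbergGroup, ∀ v : ℝ × ℝ, (∀ a ∈ A, planeCross (plane a) v = 0) →
      planeCross (plane g) v = 0 := by
    intro g v hv
    have hg : g ∈ Subgroup.closure A := hA ▸ Subgroup.mem_top g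
    induction hg using Subgroup.closure_induction with
    | mem a ha => exact hv a ha
    | one => simp
    | mul a b _ _ ha hb => rw [plane_mul, planeCross_add_left, ha, hb, add_zero]
    | inv a _ ha =>
      rw [plane_inv, ← neg_one_smul ℝ, planeCross_smul_left, ha, mul_zero]
  have hxy : planeCross (plane genX) (plane genY) = 0 := by
    refine hgen _ _ fun a ha => ?_
    rw [planeCross_swap, hgen _ (plane a) fun b hb => h0 ⟨b, Or.inl hb⟩ ⟨a, Or.inl ha⟩, neg_zero]
  simp [plane, planeCross] at hxy

lemma exists_loop_area_pos (hA : Subgroup.closure A = ⊤) :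
    ∃ l : List (ℝ × Letter A), BlockPath.Nonneg l ∧ BlockPath.disp (letterPlane A) l = 0 ∧
      0 < BlockPath.area (letterPlane A) l := by
  obtain ⟨a, b, hab⟩ := exists_letter_planeCross_pos hA
  let a' : Letter A := ⟨a.1⁻¹, by simpa using a.2.symm⟩
  let b' : Letter A := ⟨b.1⁻¹, by simpa using b.2.symm⟩
  refine ⟨[(1, a), (1, b), (1, a'), (1, b')], by simp, by simp [letterPlane, a', b'], ?_⟩
  simp only [planeCross] at hab
  simp [letterPlane, a', b', planeCross]
  linarith

/-! ### Unbounded depth -/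

/-- Suppose that the depth is at most `N`. Starting at a central element of height `R ^ 2`, where
`R = 2 * D * s ^ 2`, escape `s ^ 2` times. The length has to grow by `s ^ 2`, but it grows by at most
a constant times `N ^ 2 * s ^ 2 / D + √D * s`. -/
theorem not_exists_deadEndDepth_le (hfin : A.Finite) (hA : Subgroup.closure A = ⊤) :
    ¬ ∃ N : ℕ, ∀ g : HeisenbergGroup, deadEndDepth A g ≤ (N : ℕ∞) := by
  rintro ⟨N, hN⟩
  have := finite_letter hfin
  obtain ⟨L, hL⟩ := BlockPath.exists_isOptimalLoop (letterPlane A) (exists_loop_area_pos hA)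
  obtain ⟨B, hB1, hB⟩ := exists_letter_bound hfin
  obtain ⟨C, hC, δ, hδ, hup⟩ := exists_wordLength_le_of_near_central hfin hA hL
  have hlow := le_wordLength_of_plane_eq_zero hA hL fun a => (hB a).2.2
  set K := BlockPath.area (letterPlane A) L
  have hK : 0 < K := hL.area_pos
  set k := √K
  have hk : 0 < k := Real.sqrt_pos.2 hK
  have hkK : k ^ 2 = K := Real.sq_sqrt hK.le
  have hB0 : 0 < B := by linarith
  -- the first term makes the escape path stay in the range of the upper bound, the second one makes
  -- the quadratic term of that bound at most half of the number of escapes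
  obtain ⟨D, hD⟩ := exists_nat_ge (B * N / δ + 4 * C * B ^ 2 * N ^ 2 + 1)
  have hD0 : 0 ≤ B * N / δ := by positivity
  have hD1 : 0 ≤ 4 * C * B ^ 2 * N ^ 2 := by positivity
  have hDpos : (0 : ℝ) < D := by linarith
  have hDδ : B * N ≤ D * δ := (div_le_iff₀ hδ).1 (by linarith)
  have hDC : 4 * C * B ^ 2 * N ^ 2 ≤ D := by linarith
  set c₁ := B / (2 * k ^ 2) + C
  set c₂ := C * √(2 * D)
  have hc₁ : 0 ≤ c₁ := by positivity
  have hc₂ : 0 ≤ c₂ := by positivity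
  obtain ⟨s, hs⟩ := exists_nat_ge (2 * (c₁ + c₂) + 1)
  have hs1 : (1 : ℝ) ≤ s := by linarith
  set R : ℝ := 2 * D * (s : ℝ) ^ 2
  have hR : 0 < R := by positivity
  obtain ⟨u, hu, huN⟩ := exists_add_le_wordLength hA hN
    (central ^ (2 * ((D : ℤ) * s ^ 2) ^ 2)) (s ^ 2)
  set g := central ^ (2 * ((D : ℤ) * s ^ 2) ^ 2)
  have hgp : plane g = 0 := by simp [g, plane, coord_central_zpow]
  have hgh : height g = R ^ 2 := by
    simp only [g, height, coord_central_zpow, R]; push_cast; ring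
  have huN' : (wordLength A u : ℝ) ≤ N * s ^ 2 := by exact_mod_cast huN
  obtain ⟨hup1, huh⟩ := abs_height_le_wordLength hA hB1 hB u
  set r : ℝ := 2 * B * (N * (s : ℝ) ^ 2)
  have h1 : |(plane (g * u)).1| + |(plane (g * u)).2| ≤ r := by
    rw [plane_mul, hgp, zero_add]
    exact hup1.trans (mul_le_mul_of_nonneg_left huN' (by positivity))
  have h2 : |height (g * u) - R ^ 2| ≤ r ^ 2 := by
    rw [height_mul, hgp, hgh, planeCross_zero_left, add_zero, add_sub_cancel_left]
    refine huh.trans ?_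
    calc 2 * B ^ 2 * (wordLength A u : ℝ) ^ 2 ≤ 2 * B ^ 2 * (N * s ^ 2) ^ 2 := by gcongr
      _ ≤ r ^ 2 := by
        have : (0 : ℝ) ≤ 2 * B ^ 2 * (N * s ^ 2) ^ 2 := by positivity
        linear_combination this
  have h3 : r ≤ δ * R := by
    calc r = 2 * (B * N) * s ^ 2 := by ring
      _ ≤ 2 * (D * δ) * s ^ 2 := by gcongr
      _ = δ * R := by ring
  have hupper := hup R r (g * u) hR h1 h2 h3
  have hlower := hlow g hgp
  rw [hgh, ← hkK] at hlower
  have h7 : (wordLength A g : ℝ) + (s : ℝ) ^ 2 ≤ wordLength A (g * u) := by exact_mod_cast hu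
  set n : ℝ := (wordLength A g : ℝ)
  have hn : 0 ≤ n := Nat.cast_nonneg _
  -- complete the square in the lower bound `R ^ 2 ≤ k ^ 2 * n ^ 2 + B * n`
  have h4 : R / k ≤ n + B / (2 * k ^ 2) := by
    rw [div_le_iff₀ hk]
    have : (n + B / (2 * k ^ 2)) * k = k * n + B / (2 * k) := by field_simp
    rw [this]
    refine le_of_sq_le_sq ?_ (by positivity)
    have h5 : (k * n + B / (2 * k)) ^ 2 = k ^ 2 * n ^ 2 + B * n + (B / (2 * k)) ^ 2 := by
      field_simp; ring
    rw [h5]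
    nlinarith [sq_nonneg (B / (2 * k))]
  have h5 : C * (r ^ 2 / R) ≤ (s : ℝ) ^ 2 / 2 := by
    rw [← mul_div_assoc, div_le_iff₀ hR]
    calc C * r ^ 2 = 4 * C * B ^ 2 * N ^ 2 * ((s : ℝ) ^ 2) ^ 2 := by ring
      _ ≤ D * ((s : ℝ) ^ 2) ^ 2 := by gcongr
      _ = s ^ 2 / 2 * R := by ring
  have h6 : C * √R = c₂ * s := by
    rw [Real.sqrt_mul (by positivity), Real.sqrt_sq (by positivity), mul_assoc]
  have h8 : (s : ℝ) ^ 2 / 2 ≤ c₁ + c₂ * s := by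
    simp only [c₁]
    linarith
  have h9 : c₁ * 1 ≤ c₁ * s := mul_le_mul_of_nonneg_left hs1 hc₁
  have h10 : (2 * (c₁ + c₂) + 1) * s ≤ s * s := mul_le_mul_of_nonneg_right hs (by linarith)
  linarith

end HeisenbergGroup

theorem proposition1 (A : Set HeisenbergGroup) (hfin : A.Finite)
    (hgen : Subgroup.closure A = ⊤) :
    ¬ ∃ N : ℕ, ∀ g : HeisenbergGroup, deadEndDepth A g ≤ (N : ℕ∞) :=
  HeisenbergGroup.not_exists_deadEndDepth_le hfin hgen
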